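/- Let $G$ be a group and $\ell : G\to\mathbb Z$ a function; for $x,y\in G$ put $c(x,y)=\tfrac12\bigl(\ell(x)+\ell(y)-\ell(xy^{-1})\bigr)$, and assume - $\ell(1)=0$; - $\ell(x^{-1})=\ell(x)$ for all $x\in G$; - $c(x,y)\ge\min\{c(x,z),c(z,y)\}$ for all $x,y,z\in G$; - $G$ is generated by $S=\{x\in G\mid \ell(x)\le 1\}$ (that is, $(G,\ell)$ is a valuated group with normal forms). Let $B=\{x\in G\mid \ell(x)=0\}$ and $N=\{g\in G\mid \ell(g^2)\le \ell(g)\}$. For $x\in N$ let $N(x)=\{y\in N\mid \ell(x^{-1}y)\le\ell(x)=\ell(y)\}\cup\{1\}$. Write $A^a=a^{-1}Aa$ for $A\subseteq G$ and $a\in G$. **Theorem (Grushko–Neumann version for valuated groups).** Let $K$ be a subgroup of $G$ such that $K^g\cap B=\{1\}$ for every $g\in G$. Then there are a free subgroup $F$ of $G$ and a (possibly empty) family of subgroups $(G_i)_{i\in I}$ of $G$ such that $K$ is the internal free product $$K=F*\bigl(*_{i\in I}\,G_i\bigr)$$ (the canonical homomorphism from the abstract free product of $F$ and the $G_i$ to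 $G$ is injective with image $K$), and for every $i\in I$ there are $a_i\in G$ and $x_i\in S$ with $\ell(x_i^2)\le 1$ such that $G_i=K\cap N(x_i)^{a_i}$. (Every $x\in S$ with $\ell(x^2)\le1$ lies in $N$, so $N(x_i)$ is defined.) -/

import Mathlib

universe u

namespace ValuatedGroup

variable {G : Type*} [Group G]

/-- `c(x, y) = (ℓ(x) + ℓ(y) - ℓ(x y⁻¹)) / 2`, a possibly half-integral rational number. -/
def c (ℓ : G → ℤ) (x y : G) : ℚ :=
  ((ℓ x : ℚ) + (ℓ y : ℚ) - (ℓ (x * y⁻¹) : ℚ)) / 2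

/-- Lyndon's axioms for an integer-valued length function: `(G, ℓ)` is a valuated group. -/
structure IsLyndonLength (ℓ : G → ℤ) : Prop where
  map_one : ℓ 1 = 0
  map_inv : ∀ x : G, ℓ x⁻¹ = ℓ x
  min_le : ∀ x y z : G, min (c ℓ x z) (c ℓ z y) ≤ c ℓ x y

/-- The set `B` of elements of length zero. -/
def B (ℓ : G → ℤ) : Set G := {x | ℓ x = 0}

/-- The set `S` of elements of length at most one. -/
def S (ℓ : G → ℤ) : Set G := {x | ℓ x ≤ 1}

/-- `(G, ℓ)` is a valuated group with normal forms: it satisfies Lyndon's axioms and is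
generated by its elements of length at most one. -/
structure HasNormalForms (ℓ : G → ℤ) : Prop extends IsLyndonLength ℓ where
  closure_eq_top : Subgroup.closure (S ℓ) = ⊤

/-- The set `N = {g | ℓ(g²) ≤ ℓ(g)}`. -/
def N (ℓ : G → ℤ) : Set G := {g | ℓ (g ^ 2) ≤ ℓ g}

/-- Lyndon's relation `x ≡ y`, considered on the set `N`:
`ℓ(x⁻¹ y) ≤ ℓ(x) = ℓ(y)`. -/
def Equivalent (ℓ : G → ℤ) (x y : G) : Prop := ℓ (x⁻¹ * y) ≤ ℓ x ∧ ℓ x = ℓ y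

/-- For `x ∈ N`, the set `N(x)`: the equivalence class of `x` in `N`, together with `1`. -/
def NClass (ℓ : G → ℤ) (x : G) : Set G := {y | y ∈ N ℓ ∧ Equivalent ℓ x y} ∪ {1}

/-- The conjugate `A ^ a = a⁻¹ A a` of a subset `A` of `G`. -/
def conjSet (A : Set G) (a : G) : Set G := (fun x => a⁻¹ * x * a) '' A

/-- The subgroup `K` is the internal free product `F * (*_i H_i)` of the subgroups `F` and `H_i`:
the canonical homomorphism from the abstract free product to `G` is injective with image `K`. -/
def IsInternalFreeProduct {ι : Type*} (K F : Subgroup G) (H : ι → Subgroup G) : Prop :=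
  Function.Injective
      (Monoid.Coprod.lift F.subtype (Monoid.CoprodI.lift fun i => (H i).subtype)) ∧
    (Monoid.Coprod.lift F.subtype (Monoid.CoprodI.lift fun i => (H i).subtype)).range = K

end ValuatedGroup

namespace ValuatedGroup

/-! The cosets G/B carry the integral metric d(xB, yB) = ℓ(x⁻¹y). Lyndon's axiom is the four-point
condition of trees, and generation by `S` joins points by unit steps. In the graph of pairs at
distance one, the maximal cliques ("blocks") fit together like a tree. The hypothesis on `K` makes
it act freely on points, so only blocks can have nontrivial stabilizers. Bass–Serre theory for the
incidence tree of points and blocks then predicts that `K` is a free group times, freely, the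
stabilizers of block representatives. By `exists_eq_inter_conjSet_NClass` these stabilizers are the
sets K ∩ N(x)^a.

`exists_free_product` proves the splitting directly. `exists_adapted_gauge` gives an equivariant γ :
V → K whose points of value 1 form a transversal connected through representative blocks. Let π : P
→ K be the map from the abstract free product. Potentials in P lifting γ⁻¹ on representative blocks
are carried to all blocks and integrated to Φ : V → P by `exists_development`; this is consistent
because every cycle is filled by blocks. Then k ↦ Φ(k v) is a homomorphism inverse to π. -/

/-- Recursion along a map that decreases an `ℕ`-valued rank wherever the rank is nonzero. -/
theorem exists_rec_of_rank {α β : Type*} (δ : α → ℕ) (p : α → α)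
    (hp : ∀ x, δ x ≠ 0 → δ (p x) < δ x) (b : β) (F : α → β → β) :
    ∃ f : α → β, (∀ x, δ x = 0 → f x = b) ∧ ∀ x, δ x ≠ 0 → f x = F x (f (p x)) := by
  classical
  let wf : WellFounded (fun x y : α => δ x < δ y) := (measure δ).wf
  let step : ∀ x : α, (∀ y, δ y < δ x → β) → β := fun x ih =>
    if h : δ x = 0 then b else F x (ih (p x) (hp x h))
  refine ⟨wf.fix step, fun x hx => ?_, fun x hx => ?_⟩
  · rw [wf.fix_eq]; simp [step, hx]
  · rw [wf.fix_eq]; simp [step, hx]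

/-! ### Tree metrics, block trees and developing maps -/

/-- An integer-valued metric satisfying the four-point condition of trees. -/
structure IsTreeMetric {V : Type*} (d : V → V → ℕ) : Prop where
  eq_zero_iff : ∀ x y, d x y = 0 ↔ x = y
  symm : ∀ x y, d x y = d y x
  four_point : ∀ x y z w, d x y + d z w ≤ max (d x z + d y w) (d x w + d y z)

namespace IsTreeMetric

variable {V : Type*} {d : V → V → ℕ} {v : V}

theorem self (h : IsTreeMetric d) (x : V) : d x x = 0 := (h.eq_zero_iff x x).2 rfl

theorem triangle (h : IsTreeMetric d) (x y z : V) : d x z ≤ d x y + d y z := by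
  have := h.four_point x z y y
  have := h.self y
  have := h.symm z y
  omega

/-- The four-point condition for p, q, v, x leaves no room for d p q > 0: a point has only one
predecessor towards `v`. -/
theorem step_unique (h : IsTreeMetric d) {x p q : V} (hp : d p x = 1) (hpv : d v x = d v p + 1)
    (hq : d q x = 1) (hqv : d v x = d v q + 1) : p = q := by
  have := h.four_point p q v x
  have := h.symm p v
  have := h.symm q v
  exact (h.eq_zero_iff p q).1 (by omega)

/-- Adjacent points at the same level form a clique with the predecessor of either one; this fills
the triangles needed for integrating cocycles. -/
theorem step_le_one (h : IsTreeMetric d) {x y p : V} (hp : d p x = 1)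
    (hpv : d v x = d v p + 1) (hxy : d x y = 1) (hv : d v x = d v y) : d p y ≤ 1 := by
  have := h.four_point p y v x
  have := h.symm p v
  have := h.symm y v
  have := h.symm y x
  omega

/-- A point joined to `v` by unit steps is joined to `v` by a geodesic of unit steps. -/
theorem exists_geodesic (h : IsTreeMetric d) {x : V}
    (hx : Relation.ReflTransGen (fun a b => d a b = 1) v x) :
    Relation.ReflTransGen (fun a b => d a b = 1 ∧ d v b = d v a + 1) v x := by
  induction hx with
  | refl => exact .refl
  | @tail a b _ hab ih =>
    have t1 := h.triangle v a b
    have t2 := h.triangle v b a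
    have hba := h.symm a b
    by_cases hlt : d v b = d v a + 1
    · exact ih.tail ⟨hab, hlt⟩
    · rcases ih.cases_tail with hva | ⟨p, hvp, hpa, hpav⟩
      · subst hva
        have := h.self a
        omega
      · by_cases heq : d v a = d v b
        -- On equal levels, `a` is bypassed: its predecessor `p` is already adjacent to `b`.
        · have h1 := h.step_le_one hpa hpav hab heq
          have h2 := h.triangle v p b
          exact hvp.tail ⟨by omega, by omega⟩
        · rwa [h.step_unique (v := v) (x := a) (p := b) (q := p) (by omega) (by omega) hpa hpav]

theorem exists_step_of_chain (h : IsTreeMetric d) {x : V}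
    (hx : Relation.ReflTransGen (fun a b => d a b = 1) v x) (hne : x ≠ v) :
    ∃ y, d y x = 1 ∧ d v x = d v y + 1 := by
  rcases (h.exists_geodesic hx).cases_tail with hxv | ⟨p, -, hp⟩
  · exact (hne hxv).elim
  · exact ⟨p, hp⟩

end IsTreeMetric

/-- An integral tree metric `d` on `V` connected by unit steps, together with a set `M` of blocks:
the incidence relation `I` describes the maximal cliques of the graph of pairs at distance one. -/
structure IsBlockTree {V M : Type*} (d : V → V → ℕ) (v : V) (I : V → M → Prop) : Prop
    extends IsTreeMetric d where
  exists_step : ∀ x, x ≠ v → ∃ y, d y x = 1 ∧ d v x = d v y + 1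
  exists_block : ∀ x y, d x y = 1 → ∃ m, I x m ∧ I y m
  le_one : ∀ x y m, I x m → I y m → d x y ≤ 1
  block_unique : ∀ x y m m', x ≠ y → I x m → I y m → I x m' → I y m' → m = m'
  mem_block : ∀ x y z m, d x y = 1 → I x m → I y m → d z x ≤ 1 → d z y ≤ 1 → I z m
  nonempty : ∀ m, ∃ x, I x m

namespace IsBlockTree

variable {V M : Type*} {d : V → V → ℕ} {v : V} {I : V → M → Prop}

/-- A blockwise coboundary depends only on the pair of points, not on the block. -/
theorem exists_pair_cocycle (h : IsBlockTree d v I) {P : Type*} [Group P] (ψ : M → V → P) :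
    ∃ c : V → V → P, ∀ m x y, I x m → I y m → c x y = ψ m x * (ψ m y)⁻¹ := by
  classical
  refine ⟨fun x y => if hxy : ∃ m, I x m ∧ I y m then
    ψ hxy.choose x * (ψ hxy.choose y)⁻¹ else 1, fun m x y hx hy => ?_⟩
  have hxy : ∃ m, I x m ∧ I y m := ⟨m, hx, hy⟩
  simp only [dif_pos hxy]
  by_cases hne : x = y
  · subst hne; simp
  · rw [h.block_unique x y _ m hne hxy.choose_spec.1 hxy.choose_spec.2 hx hy]

/-- The developing map of a cocycle given blockwise by `ψ`. -/
theorem exists_development (h : IsBlockTree d v I) {P : Type*} [Group P] (ψ : M → V → P) :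
    ∃ Φ : V → P, Φ v = 1 ∧
      ∀ m x y, I x m → I y m → Φ y = Φ x * (ψ m x * (ψ m y)⁻¹) := by
  obtain ⟨c, hc⟩ := h.exists_pair_cocycle ψ
  have key : ∀ x, ∃ p : V, x ≠ v → d p x = 1 ∧ d v x = d v p + 1 := by
    intro x
    by_cases hx : x = v
    · exact ⟨v, fun h => (h hx).elim⟩
    · obtain ⟨y, hy, hyv⟩ := h.exists_step x hx
      exact ⟨y, fun _ => ⟨hy, hyv⟩⟩
  choose p hp using key
  have hne : ∀ x, d v x ≠ 0 → x ≠ v := fun x hx hxv => hx (hxv ▸ h.self x)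
  -- Integrate along predecessors; consistency remains to be checked only on edges within one level.
  obtain ⟨Φ, hΦ0, hΦ⟩ := exists_rec_of_rank (d v) p
    (fun x hx => by have := (hp x (hne x hx)).2; omega) (1 : P) (fun x a => a * c (p x) x)
  have hstep : ∀ m x y, I x m → I y m → d x y = 1 → d v y = d v x + 1 →
      Φ y = Φ x * (ψ m x * (ψ m y)⁻¹) := by
    intro m x y hx hy hxy hv
    have h0 : d v y ≠ 0 := by omega
    have hpy := hp y (hne y h0)
    have hpx : p y = x := h.step_unique hpy.1 hpy.2 hxy hv
    rw [hΦ y h0, hpx, hc m x y hx hy]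
  refine ⟨Φ, hΦ0 v (h.self v), fun m x y hx hy => ?_⟩
  by_cases hxy0 : x = y
  · subst hxy0; simp
  have hxy : d x y = 1 := by
    have h1 := h.le_one x y m hx hy
    have h2 : d x y ≠ 0 := fun h0 => hxy0 ((h.eq_zero_iff x y).1 h0)
    omega
  have hyx : d y x = 1 := h.symm x y ▸ hxy
  have t1 := h.triangle v x y
  have t2 := h.triangle v y x
  obtain hlt | heq | hgt := lt_trichotomy (d v x) (d v y)
  · exact hstep m x y hx hy hxy (by omega)
  · have h0 : d v x ≠ 0 := by
      intro h0
      exact hxy0 (((h.eq_zero_iff v x).1 h0).symm.trans ((h.eq_zero_iff v y).1 (heq ▸ h0)))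
    obtain ⟨h1, h2⟩ := hp x (hne x h0)
    have h3 := h.step_le_one h1 h2 hxy heq
    have h4 : d (p x) y = 1 := by
      have := h.triangle v (p x) y
      omega
    -- The common predecessor lies in the same block as `x` and `y`, where the increments telescope.
    have hI : I (p x) m := h.mem_block x y _ m hxy hx hy h1.le h3
    rw [hstep m _ y hI hy h4 (by omega), hstep m _ x hI hx h1 h2]
    group
  · rw [hstep m y x hy hx hyx (by omega)]
    group

/-- Two maps with the same increments along blocks agree once they agree at the base point. -/
theorem development_unique (h : IsBlockTree d v I) {P : Type*} [Group P] {f f' : V → P}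
    (h0 : f v = f' v)
    (hf : ∀ m x y, I x m → I y m → (f x)⁻¹ * f y = (f' x)⁻¹ * f' y) (x : V) : f x = f' x := by
  induction hn : d v x using Nat.strong_induction_on generalizing x with
  | _ n ih =>
    by_cases hx : x = v
    · rw [hx, h0]
    · obtain ⟨y, hy, hyv⟩ := h.exists_step x hx
      obtain ⟨m, hm, hm'⟩ := h.exists_block y x hy
      have := hf m y x hm hm'
      rw [ih (d v y) (by omega) y rfl] at this
      exact mul_left_cancel this

end IsBlockTree
end ValuatedGroup

/-! ### Free actions on block trees and the free product decomposition -/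

namespace ValuatedGroup

/-- Orbit representatives `ρ m`, with group elements carrying them back to `m`. -/
theorem exists_orbit_section (K M : Type*) [Group K] [MulAction K M] :
    ∃ (ρ : M → M) (κ : M → K), (∀ (k : K) m, ρ (k • m) = ρ m) ∧ ∀ m, κ m • ρ m = m := by
  let ρ : M → M := fun m => (Quotient.mk (MulAction.orbitRel K M) m).out
  have h : ∀ m, ∃ k : K, k • ρ m = m := fun m => by
    have : (MulAction.orbitRel K M) (ρ m) m := Quotient.mk_out (s := MulAction.orbitRel K M) m
    exact (MulAction.orbitRel K M).symm this
  choose κ hκ using h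
  refine ⟨ρ, κ, fun k m => ?_, hκ⟩
  have : Quotient.mk (MulAction.orbitRel K M) (k • m) = Quotient.mk (MulAction.orbitRel K M) m :=
    Quotient.sound (s := MulAction.orbitRel K M) ⟨k, rfl⟩
  simp only [ρ, this]

/-- A free action admits an equivariant map to the group. -/
theorem exists_gauge {K V : Type*} [Group K] [MulAction K V]
    (hfree : ∀ (k : K) (x : V), k • x = x → k = 1) :
    ∃ γ : V → K, ∀ (k : K) x, γ (k • x) = k * γ x := by
  obtain ⟨ρ, κ, hρ, hκ⟩ := exists_orbit_section K V
  refine ⟨κ, fun k x => ?_⟩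
  have h1 := hκ (k • x)
  have : ((k * κ x)⁻¹ * κ (k • x)) • ρ x = ρ x := by
    rw [mul_smul, inv_smul_eq_iff, mul_smul, hκ x, ← hρ k x, h1]
  exact (inv_mul_eq_one.1 (hfree _ _ this)).symm

variable {K V M : Type*} [Group K] [MulAction K V] [MulAction K M]
  {d : V → V → ℕ} {v : V} {I : V → M → Prop}

/-- The distance from the base point to the orbit of a point. -/
theorem exists_orbit_depth (h : IsBlockTree d v I)
    (hI : ∀ (k : K) x m, I x m → I (k • x) (k • m)) :
    ∃ δ : V → ℕ, (∀ (k : K) x, δ (k • x) = δ x) ∧ δ v = 0 ∧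
      (∀ x, δ x = 0 → ∃ k : K, k • v = x) ∧
      ∀ x, δ x ≠ 0 → ∃ y m, I x m ∧ I y m ∧ δ y < δ x := by
  -- `⨅` in `ℕ` is an attained minimum, as the family is nonempty.
  let δ : V → ℕ := fun x => ⨅ k : K, d v (k • x)
  have hle : ∀ (k : K) x, δ x ≤ d v (k • x) := fun k x => Nat.sInf_le ⟨k, rfl⟩
  have hmem : ∀ x, ∃ k : K, d v (k • x) = δ x := fun x =>
    Nat.sInf_mem (Set.range_nonempty fun k : K => d v (k • x))
  have hinv : ∀ (k : K) x, δ (k • x) = δ x := by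
    have aux : ∀ (k : K) x, δ (k • x) ≤ δ x := fun k x => by
      obtain ⟨l, hl⟩ := hmem x
      have := hle (l * k⁻¹) (k • x)
      rwa [smul_smul, inv_mul_cancel_right, hl] at this
    refine fun k x => le_antisymm (aux k x) ?_
    have := aux k⁻¹ (k • x)
    rwa [inv_smul_smul] at this
  refine ⟨δ, hinv, ?_, fun x hx => ?_, fun x hx => ?_⟩
  · have := hle 1 v
    rw [one_smul, h.self] at this
    omega
  · obtain ⟨k, hk⟩ := hmem x
    rw [hx, h.eq_zero_iff] at hk
    exact ⟨k⁻¹, by rw [hk, inv_smul_smul]⟩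
  · obtain ⟨k, hk⟩ := hmem x
    have hne : k • x ≠ v := fun hv => hx (by rw [← hk, hv, h.self])
    obtain ⟨y, hy, hyv⟩ := h.exists_step _ hne
    obtain ⟨m, hm, hm'⟩ := h.exists_block _ _ hy
    refine ⟨k⁻¹ • y, k⁻¹ • m, ?_, hI _ _ _ hm, ?_⟩
    · have := hI k⁻¹ _ _ hm'
      rwa [inv_smul_smul] at this
    · rw [hinv, ← hk, hyv]
      have := hle 1 y
      rw [one_smul] at this
      omega

/-- An equivariant gauge and block representatives such that the points of trivial gauge are
joined to the base point through representative blocks. -/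
theorem exists_adapted_gauge (h : IsBlockTree d v I)
    (hfree : ∀ (k : K) (x : V), k • x = x → k = 1)
    (hI : ∀ (k : K) x m, I x m → I (k • x) (k • m)) :
    ∃ (γ : V → K) (ρ : M → M) (κ : M → K) (δ : V → ℕ), γ v = 1 ∧
      (∀ (k : K) x, γ (k • x) = k * γ x) ∧ (∀ (k : K) m, ρ (k • m) = ρ m) ∧
      (∀ m, κ m • ρ m = m) ∧ (∀ m, ∃ g, I g (ρ m) ∧ γ g = 1) ∧
      ∀ r, γ r = 1 → r ≠ v → ∃ m g, I r (ρ m) ∧ I g (ρ m) ∧ γ g = 1 ∧ δ g < δ r := by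
  obtain ⟨δ, hδ, hδv, hδ0, hδs⟩ := exists_orbit_depth h hI
  obtain ⟨ρ₀, κ₀, hρ₀, hκ₀⟩ := exists_orbit_section K M
  obtain ⟨γ₀, hγ₀v, hγ₀⟩ : ∃ γ₀ : V → K, γ₀ v = 1 ∧ ∀ (k : K) x, γ₀ (k • x) = k * γ₀ x := by
    obtain ⟨γ, hγ⟩ := exists_gauge hfree
    exact ⟨fun x => γ x * (γ v)⁻¹, by simp, fun k x => by simp only [hγ, mul_assoc]⟩
  have hg : ∀ n : M, ∃ g, I g n ∧ ∀ y, I y n → δ g ≤ δ y := fun n => by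
    have hne : ∃ a, ∃ y, I y n ∧ δ y = a :=
      let ⟨x, hx⟩ := h.nonempty n
      ⟨_, x, hx, rfl⟩
    classical
    obtain ⟨g, hg, hgδ⟩ := Nat.find_spec hne
    exact ⟨g, hg, fun y hy => hgδ ▸ Nat.find_min' hne ⟨y, hy, rfl⟩⟩
  choose g hgI hgmin using hg
  have key : ∀ x, ∃ (p : V) (l : K), δ x ≠ 0 →
      δ p < δ x ∧ ∃ m, I (l • x) (ρ₀ m) ∧ p = g (ρ₀ m) := by
    intro x
    by_cases hx : δ x = 0
    · exact ⟨x, 1, fun h => (h hx).elim⟩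
    · obtain ⟨y, m, hxm, hym, hlt⟩ := hδs x hx
      have hm : (κ₀ m)⁻¹ • m = ρ₀ m := by rw [inv_smul_eq_iff, hκ₀]
      refine ⟨g (ρ₀ m), (κ₀ m)⁻¹, fun _ => ⟨?_, m, hm ▸ hI _ _ _ hxm, rfl⟩⟩
      have := hgmin (ρ₀ m) _ (hm ▸ hI (κ₀ m)⁻¹ _ _ hym)
      rw [hδ] at this
      omega
  choose p l hpl using key
  let o : V → V := fun x => (γ₀ x)⁻¹ • x
  have ho : ∀ (k : K) x, o (k • x) = o x := fun k x => by
    simp only [o, hγ₀, mul_inv_rev, mul_smul, inv_smul_smul]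
  have hδo : ∀ x, δ (o x) = δ x := fun x => hδ _ _
  -- The invariant correction `t` is chosen so that γ = γ₀ t⁻¹ satisfies γ(p) = l t⁻¹ at the parent
  -- p. The translate of the chosen block by γ(p)⁻¹ then contains both the gauge-1 point of the
  -- orbit and that of its parent.
  obtain ⟨t, ht0, ht⟩ := exists_rec_of_rank δ (fun x => p (o x))
    (fun x hx => by
      have := (hpl (o x) (by rwa [hδo])).1
      rwa [hδo] at this) (1 : K) (fun x a => a * (γ₀ (p (o x)))⁻¹ * l (o x))
  have htinv : ∀ (k : K) x, t (k • x) = t x := fun k x => by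
    by_cases hx : δ x = 0
    · rw [ht0 x hx, ht0 _ (by rwa [hδ])]
    · rw [ht x hx, ht _ (by rwa [hδ]), ho]
  let γ : V → K := fun x => γ₀ x * (t x)⁻¹
  have hγ : ∀ (k : K) x, γ (k • x) = k * γ x := fun k x => by
    simp only [γ, hγ₀, htinv, mul_assoc]
  have hγv : γ v = 1 := by simp [γ, hγ₀v, ht0 v hδv]
  refine ⟨γ, fun m => (γ (g (ρ₀ m)))⁻¹ • ρ₀ m, fun m => κ₀ m * γ (g (ρ₀ m)), δ, hγv, hγ,
    fun k m => by simp only [hρ₀], fun m => by rw [mul_smul, smul_inv_smul, hκ₀],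
    fun m => ⟨(γ (g (ρ₀ m)))⁻¹ • g (ρ₀ m), hI _ _ _ (hgI _), by rw [hγ, inv_mul_cancel]⟩,
    fun r hr hrv => ?_⟩
  have hδr : δ r ≠ 0 := fun h0 => by
    obtain ⟨k, rfl⟩ := hδ0 r h0
    rw [hγ, hγv, mul_one] at hr
    exact hrv (by rw [hr, one_smul])
  obtain ⟨hlt, m, hm, hpm⟩ := hpl (o r) (by rwa [hδo])
  have htr := ht r hδr
  have hr' : γ₀ r = t r := by simpa [γ, mul_inv_eq_one] using hr
  have hγp : γ (p (o r)) = l (o r) * (t r)⁻¹ := by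
    simp only [γ]
    rw [htr]
    group
  refine ⟨m, (γ (g (ρ₀ m)))⁻¹ • g (ρ₀ m), ?_, hI _ _ _ (hgI _), by rw [hγ, inv_mul_cancel], ?_⟩
  · have := hI (γ (g (ρ₀ m)))⁻¹ _ _ hm
    convert this using 1
    rw [← hpm, hγp]
    simp only [o, hr', smul_smul]
    group
    simp
  · rw [hδ, ← hpm, ← hδo r]
    exact hlt

open Monoid MulAction in
/-- The free product of a free group and the stabilizers of the fixed points of `ρ`. -/
abbrev StabilizerProduct (K : Type*) {V M : Type*} [Group K] [MulAction K M] (ρ : M → M)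
    (J : Set ({m // ρ m = m} × V)) :=
  Coprod (FreeGroup J) (CoprodI fun i : {m // ρ m = m} => stabilizer K i.1)

open Monoid MulAction in
/-- A group acting freely on the points of a block tree is the free product of a free group and
the stabilizers of representatives of the orbits of blocks. -/
theorem exists_free_product (h : IsBlockTree d v I)
    (hfree : ∀ (k : K) (x : V), k • x = x → k = 1)
    (hI : ∀ (k : K) x m, I x m → I (k • x) (k • m)) :
    ∃ (ρ : M → M) (J : Set ({m // ρ m = m} × V)) (α : FreeGroup J →* K),
      Function.Bijective (Coprod.lift α
        (CoprodI.lift fun i : {m // ρ m = m} => (stabilizer K i.1).subtype)) := by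
  classical
  obtain ⟨γ, ρ, κ, δ, hγv, hγ, hρ, hκ, hg, hr⟩ := exists_adapted_gauge h hfree hI
  -- Each `η i` is a gauge for the stabilizer alone, forced to agree with `γ` where `γ` takes values
  -- in it, so gauge-1 points also have `η i` equal to 1.
  have hη : ∀ i : {m // ρ m = m}, ∃ η : V → stabilizer K i.1,
      (∀ (k : stabilizer K i.1) x, η ((k : K) • x) = k * η x) ∧
      ∀ x (hx : γ x ∈ stabilizer K i.1), η x = ⟨γ x, hx⟩ := by
    intro i
    obtain ⟨η₀, hη₀⟩ := exists_gauge (K := stabilizer K i.1) (V := V)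
      (fun k x hk => Subtype.ext (hfree k x hk))
    have hmem : ∀ (k : stabilizer K i.1) x,
        γ ((k : K) • x) ∈ stabilizer K i.1 ↔ γ x ∈ stabilizer K i.1 := fun k x => by
      rw [hγ, Subgroup.mul_mem_cancel_left _ k.2]
    refine ⟨fun x => if hx : γ x ∈ stabilizer K i.1 then ⟨γ x, hx⟩ else η₀ x,
      fun k x => ?_, fun x hx => by simp only [dif_pos hx]⟩
    by_cases hx : γ x ∈ stabilizer K i.1
    · have hx' := (hmem k x).2 hx
      simp only [dif_pos hx, dif_pos hx']
      exact Subtype.ext (hγ _ _)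
    · have hx' := (hmem k x).not.2 hx
      simp only [dif_neg hx, dif_neg hx']
      exact hη₀ k x
  choose η hη hηγ using hη
  -- One incidence per stabilizer orbit in each representative block; those with γ = 1 belong to the
  -- lifted maximal tree and give no generator.
  let J : Set ({m // ρ m = m} × V) := {e | I e.2 e.1.1 ∧ η e.1 e.2 = 1 ∧ γ e.2 ≠ 1}
  let α : FreeGroup J →* K := FreeGroup.lift fun e => (γ e.1.2)⁻¹
  refine ⟨ρ, J, α, ?_⟩
  set π := Coprod.lift α
    (CoprodI.lift fun i : {m // ρ m = m} => (stabilizer K i.1).subtype)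
  let inc : ∀ i : {m // ρ m = m}, stabilizer K i.1 →* StabilizerProduct K ρ J := fun i =>
    Coprod.inr.comp (CoprodI.of (M := fun i : {m // ρ m = m} => stabilizer K i.1) (i := i))
  have hinc : ∀ i k, π (inc i k) = k := fun i k => by
    simp [π, inc]
  let s : {m // ρ m = m} → V → StabilizerProduct K ρ J := fun i e =>
    if he : (i, e) ∈ J then Coprod.inl (FreeGroup.of ⟨(i, e), he⟩) else 1
  have hs : ∀ i e, I e i.1 → η i e = 1 → π (s i e) = (γ e)⁻¹ := fun i e hIe hηe => by
    by_cases he : (i, e) ∈ J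
    · simp [s, dif_pos he, π, α]
    · have hγe : γ e = 1 := by
        by_contra hne
        exact he ⟨hIe, hηe, hne⟩
      simp [s, dif_neg he, hγe]
  let ψ₀ : {m // ρ m = m} → V → StabilizerProduct K ρ J := fun i x =>
    s i ((η i x : K)⁻¹ • x) * (inc i (η i x))⁻¹
  have hψ₀ : ∀ i (k : stabilizer K i.1) x, ψ₀ i ((k : K) • x) = ψ₀ i x * (inc i k)⁻¹ :=
    fun i k x => by
      simp only [ψ₀, hη, map_mul, mul_inv_rev, Subgroup.coe_mul, mul_smul, inv_smul_smul,
        mul_assoc]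
  have hψ₀1 : ∀ i x, γ x = 1 → ψ₀ i x = 1 := fun i x hx => by
    have h1 : η i x = 1 := by
      rw [hηγ i x (hx ▸ one_mem _)]
      exact Subtype.ext hx
    have h2 : (i, x) ∉ J := fun hJ => hJ.2.2 hx
    simp [ψ₀, h1, s, h2]
  have hψ₀π : ∀ i x, I x i.1 → π (ψ₀ i x) = (γ x)⁻¹ := fun i x hx => by
    have h1 : I ((η i x : K)⁻¹ • x) i.1 := by
      have := hI (η i x : K)⁻¹ _ _ hx
      rwa [inv_smul_eq_iff.2 (mem_stabilizer_iff.1 (η i x).2).symm] at this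
    have h2 : η i ((η i x : K)⁻¹ • x) = 1 := by
      have := hη i (η i x)⁻¹ x
      rwa [inv_mul_cancel] at this
    simp only [ψ₀, map_mul, map_inv, hinc]
    rw [hs i _ h1 h2, hγ]
    group
  have hρρ : ∀ m, ρ (ρ m) = ρ m := fun m => by
    have := hρ (κ m) (ρ m)
    rw [hκ] at this
    exact this.symm
  let idx : M → {m // ρ m = m} := fun m => ⟨ρ m, hρρ m⟩
  have hidx : ∀ (k : K) m, idx (k • m) = idx m := fun k m => Subtype.ext (hρ k m)
  let ψ : M → V → StabilizerProduct K ρ J := fun m x => ψ₀ (idx m) ((κ m)⁻¹ • x)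
  -- The choice of `κ` affects a potential only by a right factor, which cancels in ψ(x) ψ(y)⁻¹;
  -- hence the increments are `K`-invariant.
  have hψk : ∀ (k : K) m, ∃ a : StabilizerProduct K ρ J, ∀ x, ψ (k • m) (k • x) = ψ m x * a := by
    intro k m
    have hst : (κ (k • m))⁻¹ * k * κ m ∈ stabilizer K (idx m).1 := by
      rw [mem_stabilizer_iff, mul_smul, mul_smul]
      change _ • k • κ m • ρ m = ρ m
      rw [hκ, inv_smul_eq_iff, ← hρ k m, hκ]
    refine ⟨(inc (idx m) ⟨_, hst⟩)⁻¹, fun x => ?_⟩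
    have := hψ₀ (idx m) ⟨_, hst⟩ ((κ m)⁻¹ • x)
    rw [← this]
    simp only [ψ, hidx, smul_smul]
    congr 2
    group
  have hψi : ∀ i : {m // ρ m = m}, ∃ a : StabilizerProduct K ρ J, ∀ x, ψ i.1 x = ψ₀ i x * a := by
    intro i
    have hi : idx i.1 = i := Subtype.ext i.2
    have hst : (κ i.1)⁻¹ ∈ stabilizer K i.1 := by
      rw [mem_stabilizer_iff, inv_smul_eq_iff]
      have := hκ i.1
      rw [i.2] at this
      exact this.symm
    refine ⟨(inc i ⟨_, hst⟩)⁻¹, fun x => ?_⟩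
    have := hψ₀ i ⟨_, hst⟩ x
    rw [← this]
    simp only [ψ, hi]
  obtain ⟨Φ, hΦv, hΦ⟩ := h.exists_development ψ
  have hΦi : ∀ (i : {m // ρ m = m}) x y, I x i.1 → I y i.1 →
      Φ y = Φ x * (ψ₀ i x * (ψ₀ i y)⁻¹) := fun i x y hx hy => by
    obtain ⟨a, ha⟩ := hψi i
    rw [hΦ i.1 x y hx hy, ha, ha]
    group
  have hΦK : ∀ (k : K) x, Φ (k • x) = Φ (k • v) * Φ x := by
    intro k x
    refine h.development_unique (f := fun x => Φ (k • x)) (f' := fun x => Φ (k • v) * Φ x)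
      (by simp [hΦv]) (fun m x y hx hy => ?_) x
    obtain ⟨a, ha⟩ := hψk k m
    rw [hΦ _ _ _ (hI k x m hx) (hI k y m hy), hΦ _ _ _ hx hy, ha, ha]
    group
  let θ : K →* StabilizerProduct K ρ J := MonoidHom.mk' (fun k => Φ (k • v)) fun a b => by rw [mul_smul, hΦK]
  have hθ : ∀ k x, Φ (k • x) = θ k * Φ x := hΦK
  have hπΦ : ∀ x, π (Φ x) = γ x := by
    refine h.development_unique (f := fun x => π (Φ x)) (by simp [hΦv, hγv])
      fun m x y hx hy => ?_
    have hm : (κ m)⁻¹ • m = ρ m := by rw [inv_smul_eq_iff, hκ]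
    have hπψ : ∀ x, I x m → π (ψ m x) = (γ x)⁻¹ * κ m := fun x hx => by
      simp only [ψ]
      have hx' := hI (κ m)⁻¹ x m hx
      rw [hm] at hx'
      rw [hψ₀π (idx m) _ hx', hγ]
      group
    rw [hΦ m x y hx hy, map_mul, map_mul, map_inv, hπψ x hx, hπψ y hy]
    group
  -- Descend in depth through the connected transversal, on which the potentials of representative
  -- blocks are trivial.
  have hΦ1 : ∀ r, γ r = 1 → Φ r = 1 := by
    intro r hγr
    induction hn : δ r using Nat.strong_induction_on generalizing r with
    | _ n ih =>
      by_cases hrv : r = v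
      · rw [hrv, hΦv]
      · obtain ⟨m, g, hrm, hgm, hγg, hlt⟩ := hr r hγr hrv
        rw [hΦi (idx m) g r hgm hrm, ih _ (hn ▸ hlt) g hγg rfl, hψ₀1 _ _ hγg, hψ₀1 _ _ hγr]
        group
  have hrep : ∀ i : {m // ρ m = m}, ∃ g, I g i.1 ∧ γ g = 1 := fun i => by
    have := hg i.1
    rwa [i.2] at this
  have hΦx : ∀ i x, I x i.1 → Φ x = (ψ₀ i x)⁻¹ := fun i x hx => by
    obtain ⟨g, hgI, hγg⟩ := hrep i
    rw [hΦi i g x hgI hx, hΦ1 g hγg, hψ₀1 i g hγg]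
    group
  have hθinc : ∀ i (k : stabilizer K i.1), θ k = inc i k := fun i k => by
    obtain ⟨g, hgI, hγg⟩ := hrep i
    have h1 := hθ k g
    have h2 : I ((k : K) • g) i.1 := by
      have := hI (k : K) _ _ hgI
      rwa [mem_stabilizer_iff.1 k.2] at this
    rw [hΦ1 g hγg, mul_one, hΦx i _ h2, hψ₀, hψ₀1 i g hγg] at h1
    rw [← h1]
    group
  have hθJ : ∀ e : J, θ (γ e.1.2)⁻¹ = Coprod.inl (FreeGroup.of e) := fun e => by
    obtain ⟨⟨i, x⟩, hIx, hηx, hγx⟩ := e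
    dsimp only at hIx hηx hγx ⊢
    have h1 := hθ (γ x)⁻¹ x
    rw [hΦ1 ((γ x)⁻¹ • x) (by rw [hγ, inv_mul_cancel]), hΦx i x hIx] at h1
    rw [mul_inv_eq_one.1 h1.symm]
    have hJ : (i, x) ∈ J := ⟨hIx, hηx, hγx⟩
    simp [ψ₀, hηx, s, dif_pos hJ]
  -- Checked on generators, which gives injectivity of π; surjectivity follows from π ∘ Φ = γ.
  have hθπ : θ.comp π = MonoidHom.id _ := by
    refine Coprod.hom_ext ?_ ?_
    · refine FreeGroup.ext_hom _ _ fun e => ?_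
      simpa [π, α] using hθJ e
    · refine CoprodI.ext_hom _ _ fun i => ?_
      ext k
      simpa [π, inc] using hθinc i k
  refine ⟨Function.LeftInverse.injective (g := θ) fun x => DFunLike.congr_fun hθπ x, fun k => ?_⟩
  exact ⟨θ k, by
    change π (Φ (k • v)) = k
    rw [hπΦ, hγ, hγv, mul_one]⟩

end ValuatedGroup

/-! ### Blocks of a tree metric -/

open Pointwise

namespace ValuatedGroup

/-- The points at distance at most one from both `u` and `w`. -/
def block {V : Type*} (d : V → V → ℕ) (u w : V) : Set V := {t | d t u ≤ 1 ∧ d t w ≤ 1}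

namespace IsTreeMetric

variable {V : Type*} {d : V → V → ℕ}

theorem le_one_of_mem_block (h : IsTreeMetric d) {u w x y : V} (huw : d u w = 1)
    (hx : x ∈ block d u w) (hy : y ∈ block d u w) : d x y ≤ 1 := by
  have := h.four_point x y u w
  obtain ⟨h1, h2⟩ := hx
  obtain ⟨h3, h4⟩ := hy
  omega

/-- Blocks are cliques and the relation is symmetric, since `u` and `w` lie in the block of `x` and
`y`. So a block is determined by any two of its distinct points. -/
theorem block_eq (h : IsTreeMetric d) {u w x y : V} (huw : d u w = 1) (hxy : d x y = 1)
    (hx : x ∈ block d u w) (hy : y ∈ block d u w) : block d u w = block d x y := by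
  have hu : u ∈ block d x y := ⟨h.symm u x ▸ hx.1, h.symm u y ▸ hy.1⟩
  have hw : w ∈ block d x y := ⟨h.symm w x ▸ hx.2, h.symm w y ▸ hy.2⟩
  ext t
  exact ⟨fun ht => ⟨h.le_one_of_mem_block huw ht hx, h.le_one_of_mem_block huw ht hy⟩,
    fun ht => ⟨h.le_one_of_mem_block hxy ht hu, h.le_one_of_mem_block hxy ht hw⟩⟩

theorem left_mem_block (h : IsTreeMetric d) {u w : V} (huw : d u w = 1) : u ∈ block d u w :=
  ⟨by simp [h.self], huw.le⟩

theorem right_mem_block (h : IsTreeMetric d) {u w : V} (huw : d u w = 1) : w ∈ block d u w :=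
  ⟨h.symm u w ▸ huw.le, by simp [h.self]⟩

end IsTreeMetric

variable {K V : Type*} [Group K] [MulAction K V] {d : V → V → ℕ}

theorem smul_block (hd : ∀ (k : K) x y, d (k • x) (k • y) = d x y) (k : K) (u w : V) :
    k • block d u w = block d (k • u) (k • w) := by
  ext t
  rw [Set.mem_smul_set_iff_inv_smul_mem]
  have h1 := hd k (k⁻¹ • t) u
  have h2 := hd k (k⁻¹ • t) w
  rw [smul_inv_smul] at h1 h2
  simp only [block, Set.mem_ofPred_eq, h1, h2]

/-- The blocks of a metric as a set with an action of a group of isometries. -/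
def blocks (hd : ∀ (k : K) x y, d (k • x) (k • y) = d x y) : SubMulAction K (Set V) where
  carrier := {m | ∃ u w, d u w = 1 ∧ m = block d u w}
  smul_mem' := by
    rintro k _ ⟨u, w, huw, rfl⟩
    exact ⟨k • u, k • w, by rw [hd, huw], smul_block hd k u w⟩

instance (hd : ∀ (k : K) x y, d (k • x) (k • y) = d x y) : MulAction K (blocks hd) :=
  inferInstance

theorem smul_mem_blocks (hd : ∀ (k : K) x y, d (k • x) (k • y) = d x y) (k : K) (x : V)
    (m : blocks hd) (hx : x ∈ (m : Set V)) : k • x ∈ ((k • m : blocks hd) : Set V) :=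
  Set.smul_mem_smul_set hx

theorem IsTreeMetric.isBlockTree (h : IsTreeMetric d) {v : V}
    (hd : ∀ (k : K) x y, d (k • x) (k • y) = d x y)
    (hv : ∀ x, x ≠ v → ∃ y, d y x = 1 ∧ d v x = d v y + 1) :
    IsBlockTree d v (fun x (m : blocks hd) => x ∈ (m : Set V)) where
  toIsTreeMetric := h
  exists_step := hv
  exists_block x y hxy :=
    ⟨⟨block d x y, x, y, hxy, rfl⟩, h.left_mem_block hxy, h.right_mem_block hxy⟩
  le_one := by
    rintro x y ⟨_, u, w, huw, rfl⟩ hx hy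
    exact h.le_one_of_mem_block huw hx hy
  block_unique := by
    rintro x y ⟨_, u, w, huw, rfl⟩ ⟨_, u', w', huw', rfl⟩ hne hx hy hx' hy'
    have h0 : d x y ≠ 0 := fun h0 => hne ((h.eq_zero_iff x y).1 h0)
    have h1 := h.le_one_of_mem_block huw hx hy
    have hxy : d x y = 1 := by omega
    exact Subtype.ext ((h.block_eq huw hxy hx hy).trans (h.block_eq huw' hxy hx' hy').symm)
  mem_block := by
    rintro x y z ⟨_, u, w, huw, rfl⟩ hxy hx hy hzx hzy
    change z ∈ block d u w
    rw [h.block_eq huw hxy hx hy]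
    exact ⟨hzx, hzy⟩
  nonempty := by
    rintro ⟨_, u, w, huw, rfl⟩
    exact ⟨u, h.left_mem_block huw⟩

/-! ### From abstract to internal free products -/

open Monoid in
/-- An isomorphism from an abstract free product onto a subgroup exhibits the subgroup as the
internal free product of the images of the factors. -/
theorem isInternalFreeProduct_range {G A ι : Type*} {C : ι → Type*} [Group G] [Group A]
    [∀ i, Group (C i)] {K : Subgroup G} (α : A →* K) (β : ∀ i, C i →* K)
    (h : Function.Bijective (Coprod.lift α (CoprodI.lift β))) :
    Function.Injective (K.subtype.comp α) ∧
      IsInternalFreeProduct K (K.subtype.comp α).range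
        fun i => (K.subtype.comp (β i)).range := by
  classical
  have hα : Function.Injective (K.subtype.comp α) := by
    have : Function.Injective α := by
      intro a b hab
      exact Coprod.inl_injective (h.1 (by simpa using hab))
    exact K.subtype_injective.comp this
  have hβ : ∀ i, Function.Injective (K.subtype.comp (β i)) := fun i => by
    have : Function.Injective (β i) := by
      intro a b hab
      exact CoprodI.of_injective i (Coprod.inr_injective (h.1 (by simpa using hab)))
    exact K.subtype_injective.comp this
  let eα := MonoidHom.ofInjective hα
  let eβ := fun i => MonoidHom.ofInjective (hβ i)
  let g : Coprod (K.subtype.comp α).range (CoprodI fun i => (K.subtype.comp (β i)).range) →*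
      Coprod A (CoprodI C) :=
    Coprod.lift (Coprod.inl.comp eα.symm.toMonoidHom)
      (CoprodI.lift fun i => (Coprod.inr.comp CoprodI.of).comp (eβ i).symm.toMonoidHom)
  let g' : Coprod A (CoprodI C) →*
      Coprod (K.subtype.comp α).range (CoprodI fun i => (K.subtype.comp (β i)).range) :=
    Coprod.lift (Coprod.inl.comp eα.toMonoidHom)
      (CoprodI.lift fun i => (Coprod.inr.comp
        (CoprodI.of (M := fun i => (K.subtype.comp (β i)).range) (i := i))).comp
          (eβ i).toMonoidHom)
  have hgg' : g'.comp g = MonoidHom.id _ := by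
    refine Coprod.hom_ext ?_ (CoprodI.ext_hom _ _ fun i => ?_) <;> ext x <;> simp [g, g']
  have hg'g : g.comp g' = MonoidHom.id _ := by
    refine Coprod.hom_ext ?_ (CoprodI.ext_hom _ _ fun i => ?_) <;> ext x <;> simp [g, g']
  have hcomp : Coprod.lift (K.subtype.comp α).range.subtype
      (CoprodI.lift fun i => (K.subtype.comp (β i)).range.subtype) =
      K.subtype.comp ((Coprod.lift α (CoprodI.lift β)).comp g) := by
    refine Coprod.hom_ext ?_ (CoprodI.ext_hom _ _ fun i => ?_)
    · refine MonoidHom.ext fun x => ?_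
      obtain ⟨a, rfl⟩ := eα.surjective x
      simp only [g, eα]
      simp
      rfl
    · refine MonoidHom.ext fun x => ?_
      obtain ⟨a, rfl⟩ := (eβ i).surjective x
      simp only [g, eβ]
      simp
      rfl
  have hgbij : Function.Bijective g :=
    ⟨Function.LeftInverse.injective (g := g') fun x => DFunLike.congr_fun hgg' x,
      Function.RightInverse.surjective (g := g') fun x => DFunLike.congr_fun hg'g x⟩
  refine ⟨hα, ?_, ?_⟩
  · rw [hcomp]
    exact K.subtype_injective.comp (h.1.comp hgbij.1)
  · have hsurj : Function.Surjective ((Coprod.lift α (CoprodI.lift β)).comp g) :=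
      h.2.comp hgbij.2
    rw [hcomp, MonoidHom.range_comp, MonoidHom.range_eq_top.2 hsurj, ← MonoidHom.range_eq_map,
      Subgroup.range_subtype]

end ValuatedGroup

/-! ### The coset tree of a length function and its block stabilizers -/

namespace ValuatedGroup

section Length

variable {G : Type*} [Group G] {ℓ : G → ℤ}

namespace IsLyndonLength

/-- The number c(x⁻¹w, y⁻¹w) is the Gromov product of x and y based at w, so Lyndon's axiom is the
hyperbolic inequality for these products. -/
theorem four_point (h : IsLyndonLength ℓ) (x y z w : G) :
    ℓ (x⁻¹ * y) + ℓ (z⁻¹ * w) ≤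
      max (ℓ (x⁻¹ * z) + ℓ (y⁻¹ * w)) (ℓ (x⁻¹ * w) + ℓ (y⁻¹ * z)) := by
  have key := h.min_le (x⁻¹ * w) (y⁻¹ * w) (z⁻¹ * w)
  have e : ∀ a b : G, a⁻¹ * w * (b⁻¹ * w)⁻¹ = a⁻¹ * b := fun a b => by group
  have hzy : ℓ (z⁻¹ * y) = ℓ (y⁻¹ * z) := by
    rw [← h.map_inv, mul_inv_rev, inv_inv]
  simp only [c, e, hzy] at key
  rcases min_le_iff.1 key with h1 | h1
  · have h2 : (ℓ (x⁻¹ * y) + ℓ (z⁻¹ * w) : ℚ) ≤ ℓ (x⁻¹ * z) + ℓ (y⁻¹ * w) := by linarith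
    exact le_max_of_le_left (by exact_mod_cast h2)
  · have h2 : (ℓ (x⁻¹ * y) + ℓ (z⁻¹ * w) : ℚ) ≤ ℓ (x⁻¹ * w) + ℓ (y⁻¹ * z) := by linarith
    exact le_max_of_le_right (by exact_mod_cast h2)

theorem comm (h : IsLyndonLength ℓ) (x y : G) : ℓ (x⁻¹ * y) = ℓ (y⁻¹ * x) := by
  rw [← h.map_inv, mul_inv_rev, inv_inv]

theorem nonneg (h : IsLyndonLength ℓ) (x : G) : 0 ≤ ℓ x := by
  have := h.four_point 1 1 x x
  simp [h.map_one] at this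
  exact this

theorem mul_le (h : IsLyndonLength ℓ) (x y : G) : ℓ (x * y) ≤ ℓ x + ℓ y := by
  have := h.four_point x⁻¹ y 1 1
  simpa [h.map_one, h.map_inv] using this

/-- The elements of length zero as a subgroup. -/
def zeroSubgroup (h : IsLyndonLength ℓ) : Subgroup G where
  carrier := B ℓ
  one_mem' := h.map_one
  mul_mem' {a b} ha hb := by
    have := h.mul_le a b
    have := h.nonneg (a * b)
    simp only [B, Set.mem_ofPred_eq] at ha hb ⊢
    omega
  inv_mem' {a} ha := (h.map_inv a).trans ha

theorem mem_zeroSubgroup (h : IsLyndonLength ℓ) {x : G} : x ∈ h.zeroSubgroup ↔ ℓ x = 0 := Iff.rfl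

theorem mul_right_of_zero (h : IsLyndonLength ℓ) (x : G) {b : G} (hb : ℓ b = 0) :
    ℓ (x * b) = ℓ x := by
  have h1 := h.mul_le x b
  have h2 := h.mul_le (x * b) b⁻¹
  rw [mul_inv_cancel_right, h.map_inv] at h2
  omega

theorem mul_left_of_zero (h : IsLyndonLength ℓ) (x : G) {b : G} (hb : ℓ b = 0) :
    ℓ (b * x) = ℓ x := by
  rw [← h.map_inv, mul_inv_rev, h.mul_right_of_zero _ ((h.map_inv b).trans hb), h.map_inv]

/-- The distance `ℓ (x⁻¹ y)` on the cosets of the subgroup of elements of length zero. -/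
noncomputable def cosetDist (h : IsLyndonLength ℓ) (x y : G ⧸ h.zeroSubgroup) : ℕ :=
  (ℓ (x.out⁻¹ * y.out)).toNat

theorem cosetDist_mk (h : IsLyndonLength ℓ) (x y : G) :
    (h.cosetDist (x : G ⧸ h.zeroSubgroup) y : ℤ) = ℓ (x⁻¹ * y) := by
  obtain ⟨⟨a, ha⟩, hxa⟩ := QuotientGroup.mk_out_eq_mul h.zeroSubgroup x
  obtain ⟨⟨b, hb⟩, hyb⟩ := QuotientGroup.mk_out_eq_mul h.zeroSubgroup y
  rw [cosetDist, Int.toNat_of_nonneg (h.nonneg _), hxa, hyb]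
  have : (x * a)⁻¹ * (y * b) = a⁻¹ * (x⁻¹ * y * b) := by group
  rw [this, h.mul_left_of_zero _ ((h.map_inv a).trans ha), h.mul_right_of_zero _ hb]

theorem isTreeMetric (h : IsLyndonLength ℓ) : IsTreeMetric h.cosetDist where
  eq_zero_iff := by
    intro x y
    induction x using QuotientGroup.induction_on with | _ x
    induction y using QuotientGroup.induction_on with | _ y
    rw [QuotientGroup.eq, h.mem_zeroSubgroup, ← h.cosetDist_mk]
    norm_cast
  symm := by
    intro x y
    induction x using QuotientGroup.induction_on with | _ x
    induction y using QuotientGroup.induction_on with | _ y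
    have := h.comm x y
    rw [← h.cosetDist_mk, ← h.cosetDist_mk] at this
    exact_mod_cast this
  four_point := by
    intro x y z w
    induction x using QuotientGroup.induction_on with | _ x
    induction y using QuotientGroup.induction_on with | _ y
    induction z using QuotientGroup.induction_on with | _ z
    induction w using QuotientGroup.induction_on with | _ w
    have := h.four_point x y z w
    simp only [← h.cosetDist_mk] at this
    exact_mod_cast this

theorem cosetDist_smul (h : IsLyndonLength ℓ) (k : G) (x y : G ⧸ h.zeroSubgroup) :
    h.cosetDist (k • x) (k • y) = h.cosetDist x y := by
  induction x using QuotientGroup.induction_on with | _ x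
  induction y using QuotientGroup.induction_on with | _ y
  have : (h.cosetDist ((k * x : G) : G ⧸ h.zeroSubgroup) ((k * y : G) : G ⧸ h.zeroSubgroup) : ℤ) =
      h.cosetDist (x : G ⧸ h.zeroSubgroup) y := by
    rw [h.cosetDist_mk, h.cosetDist_mk]
    congr 1
    group
  exact_mod_cast this

end IsLyndonLength

theorem HasNormalForms.exists_chain (h : HasNormalForms ℓ) (g : G) :
    Relation.ReflTransGen (fun a b => h.cosetDist a b = 1)
      ((1 : G) : G ⧸ h.zeroSubgroup) (g : G ⧸ h.zeroSubgroup) := by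
  have step : ∀ x s : G, ℓ s ≤ 1 →
      Relation.ReflTransGen (fun a b => h.cosetDist a b = 1)
        ((1 : G) : G ⧸ h.zeroSubgroup) (x : G ⧸ h.zeroSubgroup) →
      Relation.ReflTransGen (fun a b => h.cosetDist a b = 1)
        ((1 : G) : G ⧸ h.zeroSubgroup) ((x * s : G) : G ⧸ h.zeroSubgroup) := by
    intro x s hs hx
    have hd := h.cosetDist_mk x (x * s)
    rw [inv_mul_cancel_left] at hd
    have := h.nonneg s
    by_cases h0 : ℓ s = 0
    · rw [h0] at hd
      have he := (h.isTreeMetric.eq_zero_iff _ _).1 (Int.natCast_eq_zero.1 hd)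
      exact he ▸ hx
    · exact hx.tail (by omega)
  have hg : g ∈ Subgroup.closure (S ℓ) := h.closure_eq_top ▸ Subgroup.mem_top g
  induction hg using Subgroup.closure_induction_right with
  | one => exact .refl
  | mul_right x hx y hy ih => exact step x y hy ih
  | mul_inv_cancel x hx y hy ih => exact step x y⁻¹ ((h.map_inv y).trans_le hy) ih

/-- This lets a block with trivial stabilizer be described by x = 1, as `K` meets `B` trivially. -/
theorem NClass_one (h : IsLyndonLength ℓ) : NClass ℓ 1 = B ℓ := by
  ext y
  simp only [NClass, N, Equivalent, B, Set.mem_union, Set.mem_ofPred_eq, inv_one, one_mul,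
    h.map_one, Set.mem_singleton_iff]
  constructor
  · rintro (hy | rfl)
    · exact hy.2.2.symm
    · exact h.map_one
  · intro hy
    have := h.mul_le y y
    exact Or.inl ⟨by rw [pow_two]; omega, hy.le, hy.symm⟩

theorem mem_conjSet {A : Set G} {a x : G} : x ∈ conjSet A a ↔ a * x * a⁻¹ ∈ A := by
  constructor
  · rintro ⟨y, hy, rfl⟩
    convert hy using 1
    group
  · intro hx
    exact ⟨_, hx, by group⟩

theorem eq_one_of_mem_of_length_conj_eq_zero {K : Subgroup G}
    (hK : ∀ g : G, conjSet (K : Set G) g ∩ B ℓ = {1}) {k : G} (hk : k ∈ K) (g : G)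
    (h0 : ℓ (g⁻¹ * k * g) = 0) : k = 1 := by
  have hmem : g⁻¹ * k * g ∈ conjSet (K : Set G) g ∩ B ℓ := ⟨⟨k, hk, rfl⟩, h0⟩
  rw [hK, Set.mem_singleton_iff] at hmem
  calc k = g * (g⁻¹ * k * g) * g⁻¹ := by group
    _ = 1 := by rw [hmem]; group

/-- The stabilizer of a block in a subgroup meeting the conjugates of `B` trivially. -/
theorem exists_eq_inter_conjSet_NClass (h : IsLyndonLength ℓ) {K : Subgroup G}
    (hK : ∀ g : G, conjSet (K : Set G) g ∩ B ℓ = {1}) {u w : G ⧸ h.zeroSubgroup}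
    (huw : h.cosetDist u w = 1) :
    ∃ a x : G, x ∈ S ℓ ∧ ℓ (x ^ 2) ≤ 1 ∧
      {k | k ∈ K ∧ k • block h.cosetDist u w = block h.cosetDist u w} =
        (K : Set G) ∩ conjSet (NClass ℓ x) a := by
  have hT := h.isTreeMetric
  set m := block h.cosetDist u w with hm
  by_cases htriv : ∀ k ∈ K, k • m = m → k = 1
  · refine ⟨1, 1, h.map_one.trans_le zero_le_one, by simp [h.map_one], ?_⟩
    ext k
    simp only [NClass_one h, Set.mem_inter_iff, SetLike.mem_coe, Set.mem_ofPred_eq, mem_conjSet]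
    constructor
    · rintro ⟨hk, hkm⟩
      rw [htriv k hk hkm]
      exact ⟨K.one_mem, by simp [B, h.map_one]⟩
    · rintro ⟨hk, hkB⟩
      have : k = 1 := eq_one_of_mem_of_length_conj_eq_zero hK hk 1 (by simpa [B] using hkB)
      exact ⟨hk, by rw [this, one_smul]⟩
  push Not at htriv
  obtain ⟨k₀, hk₀K, hk₀m, hk₀1⟩ := htriv
  obtain ⟨g, rfl⟩ := QuotientGroup.mk_surjective u
  set p : G ⧸ h.zeroSubgroup := (g : G ⧸ h.zeroSubgroup) with hp
  have hpm : p ∈ m := hT.left_mem_block huw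
  have hsm : ∀ k : G, k • m = m → ∀ q ∈ m, k • q ∈ m := fun k hk q hq =>
    hk ▸ Set.smul_mem_smul_set hq
  have hdist : ∀ a b : G, (h.cosetDist (a • p) (b • p) : ℤ) =
      ℓ ((g⁻¹ * a * g)⁻¹ * (g⁻¹ * b * g)) := fun a b => by
    refine (h.cosetDist_mk (a * g) (b * g)).trans ?_
    congr 1
    group
  have hdist1 : ∀ b : G, (h.cosetDist p (b • p) : ℤ) = ℓ (g⁻¹ * b * g) := fun b => by
    have := hdist 1 b
    rw [one_smul] at this
    rw [this]
    congr 1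
    group
  have hsq : ∀ b : G, (g⁻¹ * b * g) ^ 2 = g⁻¹ * (b * b) * g := fun b => by
    rw [pow_two]; group
  -- The points p, k p and k² p lie in one clique, and k p ≠ p by freeness.
  have hstab : ∀ k ∈ K, k • m = m → k ≠ 1 →
      ℓ (g⁻¹ * k * g) = 1 ∧ ℓ ((g⁻¹ * k * g) ^ 2) ≤ 1 := by
    intro k hk hkm hk1
    have h1 := hsm k hkm p hpm
    have h2 := hsm k hkm _ h1
    rw [smul_smul] at h2
    have h3 := hT.le_one_of_mem_block huw hpm h1
    have h4 := hT.le_one_of_mem_block huw hpm h2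
    have h5 := h.nonneg (g⁻¹ * k * g)
    have h6 : ℓ (g⁻¹ * k * g) ≠ 0 := fun h0 =>
      hk1 (eq_one_of_mem_of_length_conj_eq_zero hK hk g h0)
    rw [hsq, ← hdist1]
    rw [← hdist1] at h5 h6 ⊢
    omega
  obtain ⟨hx1, hx2⟩ := hstab k₀ hk₀K hk₀m hk₀1
  refine ⟨g⁻¹, g⁻¹ * k₀ * g, hx1.le, hx2, ?_⟩
  ext k
  simp only [Set.mem_inter_iff, SetLike.mem_coe, Set.mem_ofPred_eq, mem_conjSet, inv_inv]
  refine and_congr_right fun hk => ?_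
  constructor
  · intro hkm
    by_cases hk1 : k = 1
    · exact Or.inr (by simp [hk1])
    · obtain ⟨hy1, hy2⟩ := hstab k hk hkm hk1
      refine Or.inl ⟨hy2.trans hy1.ge, ?_, hx1.trans hy1.symm⟩
      rw [← hdist, hx1]
      exact_mod_cast hT.le_one_of_mem_block huw (hsm k₀ hk₀m p hpm) (hsm k hkm p hpm)
  -- Closeness to p and k₀ p puts k p in `m`; the condition defining `N` then puts k² p there. So
  -- `m` is the block of (p, k p) and also of (k p, k² p), and `k` maps the first pair to the
  -- second.
  · rintro (⟨hyN, hyx, hyl⟩ | hy1)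
    · rw [hx1] at hyl hyx
      have hy2 : ℓ ((g⁻¹ * k * g) ^ 2) ≤ ℓ (g⁻¹ * k * g) := hyN
      rw [hsq, ← hdist1, ← hdist1] at hy2
      rw [← hdist] at hyx
      rw [← hdist1] at hyl hx1
      have e1 : h.cosetDist p (k₀ • p) = 1 := by exact_mod_cast hx1
      have e2 : h.cosetDist p (k • p) = 1 := by exact_mod_cast hyl.symm
      have e3 : h.cosetDist (k • p) (k • k • p) = 1 := by rw [h.cosetDist_smul, e2]
      have e4 : h.cosetDist p (k • k • p) ≤ 1 := by rw [smul_smul]; omega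
      have e5 : h.cosetDist (k₀ • p) (k • p) ≤ 1 := by exact_mod_cast hyx
      have b1 : m = block h.cosetDist p (k₀ • p) :=
        hT.block_eq huw e1 hpm (hsm k₀ hk₀m p hpm)
      have b2 : k • p ∈ m := by
        rw [b1]
        exact ⟨by rw [hT.symm, e2], by rw [hT.symm]; exact e5⟩
      have b3 : m = block h.cosetDist p (k • p) := hT.block_eq huw e2 hpm b2
      have b4 : k • k • p ∈ m := by
        rw [b3]
        exact ⟨by rw [hT.symm]; exact e4, by rw [hT.symm, e3]⟩
      have b5 : m = block h.cosetDist (k • p) (k • k • p) := hT.block_eq huw e3 b2 b4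
      conv_lhs => rw [b3]
      rw [smul_block h.cosetDist_smul, ← b5]
    · have hy : g⁻¹ * k * g = 1 := hy1
      have : k = 1 := eq_one_of_mem_of_length_conj_eq_zero hK hk g (by rw [hy, h.map_one])
      rw [this, one_smul]

end Length

end ValuatedGroup

/-! ### The decomposition of `K` -/

open ValuatedGroup in
theorem theorem4p1 {G : Type u} [Group G] (ℓ : G → ℤ) (hℓ : ValuatedGroup.HasNormalForms ℓ)
    (K : Subgroup G)
    (hK : ∀ g : G, ValuatedGroup.conjSet (K : Set G) g ∩ ValuatedGroup.B ℓ = {1}) :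
    ∃ (F : Subgroup G) (ι : Type u) (H : ι → Subgroup G),
      IsFreeGroup F ∧
      ValuatedGroup.IsInternalFreeProduct K F H ∧
      ∀ i : ι, ∃ a x : G, x ∈ ValuatedGroup.S ℓ ∧ ℓ (x ^ 2) ≤ 1 ∧
        (H i : Set G) =
          (K : Set G) ∩ ValuatedGroup.conjSet (ValuatedGroup.NClass ℓ x) a := by
  have hd : ∀ (k : K) (x y : G ⧸ hℓ.zeroSubgroup),
      hℓ.cosetDist (k • x) (k • y) = hℓ.cosetDist x y :=
    fun k x y => hℓ.cosetDist_smul (k : G) x y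
  have hfree : ∀ (k : K) (x : G ⧸ hℓ.zeroSubgroup), k • x = x → k = 1 := by
    intro k x hkx
    obtain ⟨g, rfl⟩ := QuotientGroup.mk_surjective x
    have h1 : ((g : G) : G ⧸ hℓ.zeroSubgroup) = ((k * g : G) : G ⧸ hℓ.zeroSubgroup) := hkx.symm
    rw [QuotientGroup.eq, ← mul_assoc] at h1
    exact Subtype.ext (eq_one_of_mem_of_length_conj_eq_zero hK k.2 g h1)
  have hB := hℓ.isTreeMetric.isBlockTree (v := ((1 : G) : G ⧸ hℓ.zeroSubgroup)) hd fun x hx => by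
    obtain ⟨g, rfl⟩ := QuotientGroup.mk_surjective x
    exact hℓ.isTreeMetric.exists_step_of_chain (hℓ.exists_chain g) hx
  obtain ⟨ρ, J, α, hα⟩ := exists_free_product (K := K) hB hfree (smul_mem_blocks hd)
  obtain ⟨hinj, hprod⟩ := isInternalFreeProduct_range α _ hα
  refine ⟨_, _, _, IsFreeGroup.ofMulEquiv (MonoidHom.ofInjective hinj), hprod, ?_⟩
  rintro ⟨⟨_, u, w, huw, rfl⟩, hi⟩
  obtain ⟨a, x, hxS, hx2, heq⟩ := exists_eq_inter_conjSet_NClass hℓ.toIsLyndonLength hK huw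
  refine ⟨a, x, hxS, hx2, ?_⟩
  rw [← heq]
  ext k
  constructor
  · rintro ⟨⟨k, hk⟩, rfl⟩
    exact ⟨k.2, congrArg Subtype.val (MulAction.mem_stabilizer_iff.1 hk)⟩
  · rintro ⟨hk, hkm⟩
    exact ⟨⟨⟨k, hk⟩, Subtype.ext hkm⟩, rfl⟩
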